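/- Let $\mathbb R_+=(0,\infty)$ and let $|\cdot|_\infty$ be the sup-norm. A real $n\times m$ matrix $\Theta$ is called uniformly $\psi$-approximable if for every sufficiently large real $t$ there are $x\in\mathbb Z^m$, $y\in\mathbb Z^n$ with $0<|x|_\infty\le t$ and $|\Theta x-y|_\infty\le\psi(t)$. For a bijection $g:\mathbb R_+\to\mathbb R_+$ let $g^-$ be its inverse, and let ${}^t\Theta$ be the transpose of $\Theta$. Let $n=1$, $m=2$, let $\Theta$ be a real $1\times2$ matrix, and let $\psi:\mathbb R_+\to\mathbb R_+$ be a decreasing bijection such that $f(t)=t\psi(t)$ is also a bijection of $\mathbb R_+$ onto itself. Then: (i) if $f$ is decreasing and $\Theta$ is uniformly $\psi$-approximable, then ${}^t\Theta$ is uniformly $\phi$-approximable, where $\phi(t)=\frac{4}{3t}\,\psi^-\!\left(\frac{2}{3t}\right)$; (ii) if $f$ is increasing and ${}^t\Theta$ is uniformly $\psi$-approximable, then $\Theta$ is uniformly $\phi$-approximable, where $\phi(t)=\frac{2}{3f^-(t/2)}$. These functions improve Jarník's: for all $\varepsilon,\delta,t>0$ one has $\frac{4}{3t}\psi^-\!\left(\frac{2}{3t}\right)<\frac{12(1+\varepsilon+\delta)}{t}\psi^-\!\left(\frac1t\right)$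 if $f$ is decreasing, and $\frac{2}{3f^-(t/2)}<\frac{4(1+\varepsilon+\delta)}{f^-(t/2)}$ if $f$ is increasing. -/

import Mathlib

open Set Filter Matrix

/-- `Θ` is uniformly `ψ`-approximable: for every sufficiently large real `t` there are integer
vectors `x ∈ ℤ^m`, `y ∈ ℤ^n` with `0 < |x|_∞ ≤ t` and `|Θ x - y|_∞ ≤ ψ t`.
The norms below are the sup-norms of `Fin m → ℝ` and `Fin n → ℝ`. Only the values of `ψ` at
large positive arguments matter, so a function on the positive reals is given by any
extension of it to `ℝ`. -/
def UniformlyApproximable {n m : ℕ} (Θ : Matrix (Fin n) (Fin m) ℝ) (ψ : ℝ → ℝ) : Prop :=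
  ∀ᶠ t : ℝ in atTop, ∃ (x : Fin m → ℤ) (y : Fin n → ℤ),
    0 < ‖(fun j => (x j : ℝ))‖ ∧ ‖(fun j => (x j : ℝ))‖ ≤ t ∧
      ‖Θ *ᵥ (fun j => (x j : ℝ)) - (fun i => (y i : ℝ))‖ ≤ ψ t

/-- `g` is invertible as a map from the positive reals to the positive reals. -/
def PosInvertible (g : ℝ → ℝ) : Prop :=
  BijOn g (Ioi 0) (Ioi 0)

/-- The inverse function, on the positive reals, of a map that is invertible as a map from the
positive reals to the positive reals. -/
noncomputable def posInv (g : ℝ → ℝ) : ℝ → ℝ :=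
  Function.invFunOn g (Ioi 0)

theorem posInv_spec {g : ℝ → ℝ} (hg : PosInvertible g) {t : ℝ} (ht : 0 < t) :
    0 < posInv g t ∧ g (posInv g t) = t ∧ posInv g (g t) = t := by
  refine ⟨?_, ?_, ?_⟩
  · exact hg.surjOn.mapsTo_invFunOn ht
  · exact hg.surjOn.rightInvOn_invFunOn ht
  · exact hg.injOn.leftInvOn_invFunOn ht

/-! The hypothesis is used at a scale `s` with `ψ s = 2/(3t)` in (i) and `s * ψ s = t/2` in (ii).
Take an integer vector `v ∈ ℤ³` giving a best approximation at height at most `s`, and seek a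
nonzero dual integer vector in the required box. On the plane orthogonal to `v` the three forms
bounding the box are linearly dependent, so the box cuts out a parallelogram trimmed by a third
strip.

If the strip is wide enough, the section contains an affine hexagon with 3/4 of the parallelogram's
area, and Minkowski's theorem applies (`exists_simultaneous`, `exists_linear_form`); the factors 3
in the constants come from here.

If it is too narrow, the failed inequality together with the monotonicity of `t * ψ t` puts in the
box the cross product of `v` with a neighbouring best approximation: the next one in (i), the
preceding one in (ii). This dichotomy is `exists_simultaneous_of_uniform` and
`exists_linear_form_of_uniform`. -/

/-! ### Minkowski's theorem for a hexagonal prism. -/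

theorem volume_hexagon :
    MeasureTheory.volume {p : ℝ × ℝ | |p.1| ≤ 1 ∧ |p.2| ≤ 1 ∧ |p.1 - p.2| ≤ 1} ≥
      ENNReal.ofReal 3 := by
  set f : ℝ → ℝ := fun u => max (-1) (u - 1) with hf
  set g : ℝ → ℝ := fun u => min 1 (u + 1) with hg
  have hsub : regionBetween f g (Ioc (-1) 1) ⊆
      {p : ℝ × ℝ | |p.1| ≤ 1 ∧ |p.2| ≤ 1 ∧ |p.1 - p.2| ≤ 1} := by
    rintro ⟨u, v⟩ ⟨⟨hu1, hu2⟩, hv1, hv2⟩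
    simp only [hf, hg, max_lt_iff, lt_min_iff] at hv1 hv2 hu1 hu2
    simp only [mem_ofPred_eq, abs_le]
    refine ⟨⟨?_, ?_⟩, ⟨?_, ?_⟩, ?_, ?_⟩ <;> linarith
  have hfc : Continuous f := by fun_prop
  have hgc : Continuous g := by fun_prop
  have hvol : MeasureTheory.volume (regionBetween f g (Ioc (-1) 1)) = ENNReal.ofReal 3 := by
    rw [MeasureTheory.Measure.volume_eq_prod,
      volume_regionBetween_eq_integral (hfc.integrableOn_Ioc) (hgc.integrableOn_Ioc)
        measurableSet_Ioc]
    · congr 1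
      rw [← intervalIntegral.integral_of_le (by norm_num)]
      have hi : ∀ a b : ℝ, IntervalIntegrable (g - f) MeasureTheory.volume a b :=
        fun a b => (hgc.sub hfc).intervalIntegrable a b
      rw [← intervalIntegral.integral_add_adjacent_intervals (hi (-1) 0) (hi 0 1)]
      have h1 : ∫ u in (-1 : ℝ)..0, (g - f) u = ∫ u in (-1 : ℝ)..0, (u + 2) := by
        refine intervalIntegral.integral_congr fun u hu => ?_
        rw [uIcc_of_le (by norm_num)] at hu
        simp only [hf, hg, Pi.sub_apply]
        rw [min_eq_right (by linarith [hu.2]), max_eq_left (by linarith [hu.2])]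
        ring
      have h2 : ∫ u in (0 : ℝ)..1, (g - f) u = ∫ u in (0 : ℝ)..1, (2 - u) := by
        refine intervalIntegral.integral_congr fun u hu => ?_
        rw [uIcc_of_le (by norm_num)] at hu
        simp only [hf, hg, Pi.sub_apply]
        rw [min_eq_left (by linarith [hu.1]), max_eq_right (by linarith [hu.1])]
        ring
      rw [h1, h2, intervalIntegral.integral_add (by simp) (by simp),
        intervalIntegral.integral_sub (by simp) (by simp)]
      simp
      norm_num
    · intro u hu
      simp only [hf, hg]
      exact max_le (le_min (by norm_num) (by linarith [hu.1]))
        (le_min (by linarith [hu.2]) (by linarith))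
  rw [ge_iff_le, ← hvol]
  exact MeasureTheory.measure_mono hsub

/-- The product of an open interval of length two with a hexagon. -/
def hexagonalPrism : Set (Fin 3 → ℝ) :=
  {u | |u 0| < 1 ∧ |u 1| ≤ 1 ∧ |u 2| ≤ 1 ∧ |u 1 - u 2| ≤ 1}

theorem volume_hexagonalPrism : ENNReal.ofReal 6 ≤ MeasureTheory.volume hexagonalPrism := by
  have e1 := MeasureTheory.volume_preserving_piFinSuccAbove (fun _ : Fin 3 => ℝ) 0
  have e2 := (MeasureTheory.MeasurePreserving.id (MeasureTheory.volume : MeasureTheory.Measure ℝ)).prod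
    (MeasureTheory.volume_preserving_finTwoArrow ℝ)
  set H : Set (ℝ × ℝ) := {p : ℝ × ℝ | |p.1| ≤ 1 ∧ |p.2| ≤ 1 ∧ |p.1 - p.2| ≤ 1} with hH
  have hmeas : MeasurableSet H := by
    have h1 : IsClosed {p : ℝ × ℝ | |p.1| ≤ 1} := isClosed_le (by fun_prop) (by fun_prop)
    have h2 : IsClosed {p : ℝ × ℝ | |p.2| ≤ 1} := isClosed_le (by fun_prop) (by fun_prop)
    have h3 : IsClosed {p : ℝ × ℝ | |p.1 - p.2| ≤ 1} := isClosed_le (by fun_prop) (by fun_prop)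
    exact (h1.inter (h2.inter h3)).measurableSet
  have hm : MeasurableSet (Ioo (-1 : ℝ) 1 ×ˢ H) := measurableSet_Ioo.prod hmeas
  have h := (e2.comp e1).measure_preimage hm.nullMeasurableSet
  have hset : hexagonalPrism = (Prod.map id (MeasurableEquiv.finTwoArrow (α := ℝ)) ∘
      (MeasurableEquiv.piFinSuccAbove (fun _ : Fin 3 => ℝ) 0)) ⁻¹' (Ioo (-1 : ℝ) 1 ×ˢ H) := by
    ext u
    simp only [hexagonalPrism, hH, mem_ofPred_eq, mem_preimage, Function.comp_apply, mem_prod,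
      mem_Ioo, Prod.map, abs_lt]
    rfl
  rw [hset, h, MeasureTheory.Measure.prod_prod, Real.volume_Ioo,
    show (6 : ℝ) = (1 - (-1)) * 3 by norm_num, ENNReal.ofReal_mul (by norm_num)]
  gcongr
  exact volume_hexagon

theorem convex_hexagonalPrism : Convex ℝ hexagonalPrism := by
  rintro x ⟨hx0, hx1, hx2, hx3⟩ y ⟨hy0, hy1, hy2, hy3⟩ a b ha hb hab
  obtain rfl : b = 1 - a := by linarith
  have key : ∀ s t : ℝ, |s| ≤ 1 → |t| ≤ 1 → |a * s + (1 - a) * t| ≤ 1 := by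
    intro s t hs ht
    rw [abs_le] at *
    constructor <;> nlinarith
  refine ⟨?_, ?_, ?_, ?_⟩
  · simp only [Pi.add_apply, Pi.smul_apply, smul_eq_mul]
    rw [abs_lt] at *
    rcases ha.eq_or_lt with rfl | ha
    · simpa using hy0
    · constructor <;> nlinarith
  · simpa using key _ _ hx1 hy1
  · simpa using key _ _ hx2 hy2
  · have := key _ _ hx3 hy3
    simp only [Pi.add_apply, Pi.smul_apply, smul_eq_mul]
    convert this using 2
    ring

theorem neg_mem_hexagonalPrism {u : Fin 3 → ℝ} (hu : u ∈ hexagonalPrism) :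
    -u ∈ hexagonalPrism := by
  obtain ⟨h0, h1, h2, h3⟩ := hu
  refine ⟨by simpa using h0, by simpa using h1, by simpa using h2, ?_⟩
  rw [abs_sub_comm] at h3
  simp only [Pi.neg_apply]
  convert h3 using 2
  ring

/-- Minkowski's theorem for the preimage of the hexagonal prism under an invertible matrix. -/
theorem exists_int_mulVec_mem_hexagonalPrism (M : Matrix (Fin 3) (Fin 3) ℝ) (h0 : M.det ≠ 0)
    (h1 : |M.det| < 3 / 4) :
    ∃ z : Fin 3 → ℤ, z ≠ 0 ∧ (M *ᵥ fun i => (z i : ℝ)) ∈ hexagonalPrism := by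
  set b := Pi.basisFun ℝ (Fin 3)
  set Λ := (Submodule.span ℤ (Set.range b)).toAddSubgroup with hΛ
  have hdet : LinearMap.det (Matrix.toLin' M) ≠ 0 := by rwa [LinearMap.det_toLin']
  have : Countable Λ := by
    change Countable (Submodule.span ℤ (Set.range b))
    infer_instance
  have hvol : MeasureTheory.volume (ZSpan.fundamentalDomain b) = 1 := by
    rw [ZSpan.fundamentalDomain_pi_basisFun, MeasureTheory.volume_pi_pi]
    simp
  obtain ⟨⟨x, hx⟩, hne, hmem⟩ :=
    MeasureTheory.exists_ne_zero_mem_lattice_of_measure_mul_two_pow_lt_measure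
      (s := Matrix.toLin' M ⁻¹' hexagonalPrism) (L := Λ)
      (ZSpan.isAddFundamentalDomain' b MeasureTheory.volume)
      (fun x hx => by
        rw [mem_preimage, map_neg]
        exact neg_mem_hexagonalPrism hx)
      (convex_hexagonalPrism.linear_preimage _)
      (by
        rw [MeasureTheory.Measure.addHaar_preimage_linearMap _ hdet, hvol, LinearMap.det_toLin',
          one_mul, Module.finrank_fin_fun]
        -- What remains is `8 < 6 / |det M|`, the hypothesis on the determinant.
        refine lt_of_lt_of_le ?_ (mul_le_mul_right volume_hexagonalPrism _)
        rw [← ENNReal.ofReal_mul (abs_nonneg _), abs_inv,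
          show (2 : ENNReal) ^ 3 = ENNReal.ofReal 8 by norm_num]
        have hp := abs_pos.2 h0
        rw [ENNReal.ofReal_lt_ofReal_iff (by positivity), inv_mul_eq_div, lt_div_iff₀ hp]
        linarith)
  rw [hΛ, Submodule.mem_toAddSubgroup, b.mem_span_iff_repr_mem ℤ] at hx
  choose z hz using hx
  have hxz : x = fun i => (z i : ℝ) := by
    funext i
    simpa [b] using (hz i).symm
  refine ⟨z, ?_, ?_⟩
  · rintro rfl
    exact hne (Subtype.ext (hxz.trans (by ext; simp)))
  · rw [← hxz]
    simpa using hmem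

/-- For `0 ≤ β ≤ α` write `α u - β v = (α - β) u + β (u - v)`, of absolute value at most `α`; the
other sign and order cases are symmetric. -/
theorem abs_mul_sub_mul_le {α β u v C : ℝ} (hαβ : 0 ≤ α * β) (hα : |α| ≤ C) (hβ : |β| ≤ C)
    (hu : |u| ≤ 1) (hv : |v| ≤ 1) (huv : |u - v| ≤ 1) : |α * u - β * v| ≤ C := by
  rw [abs_le] at *
  rcases mul_nonneg_iff.1 hαβ with ⟨h1, h2⟩ | ⟨h1, h2⟩ <;> rcases le_total α β with h | h <;>
    constructor <;> nlinarith

/-- Minkowski's theorem in a slice: the forms `M₁`, `M₂` and the combination `α M₁ - β M₂` can be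
made small simultaneously at a nonzero integer point where `|M₀| < 1`. -/
theorem exists_int_forms_le (M : Matrix (Fin 3) (Fin 3) ℝ) {P R C α β : ℝ} (hP : 0 < P)
    (hR : 0 < R) (hα : |α| * P ≤ C) (hβ : |β| * R ≤ C) (h0 : M.det ≠ 0)
    (h1 : 4 * |M.det| < 3 * (P * R)) :
    ∃ z : Fin 3 → ℤ, z ≠ 0 ∧ |(M *ᵥ fun i => (z i : ℝ)) 0| < 1 ∧
      |(M *ᵥ fun i => (z i : ℝ)) 1| ≤ P ∧ |(M *ᵥ fun i => (z i : ℝ)) 2| ≤ R ∧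
      |α * (M *ᵥ fun i => (z i : ℝ)) 1 - β * (M *ᵥ fun i => (z i : ℝ)) 2| ≤ C := by
  -- The strip `|u - v| ≤ 1` helps only when both coefficients have the same sign; `σ` reflects the
  -- second coordinate if they do not.
  obtain ⟨σ, hσ, hs⟩ : ∃ σ : ℝ, (σ = 1 ∨ σ = -1) ∧ 0 ≤ α * (σ * β) := by
    rcases le_total 0 (α * β) with h | h
    · exact ⟨1, Or.inl rfl, by simpa using h⟩
    · exact ⟨-1, Or.inr rfl, by linarith⟩
  have hσσ : σ * σ = 1 := by rcases hσ with rfl | rfl <;> norm_num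
  have hσa : |σ| = 1 := by rcases hσ with rfl | rfl <;> norm_num
  set D : Matrix (Fin 3) (Fin 3) ℝ := Matrix.diagonal ![1, P⁻¹, σ * R⁻¹] with hD
  have hdet : (D * M).det = σ * (P⁻¹ * R⁻¹) * M.det := by
    rw [Matrix.det_mul, hD, Matrix.det_diagonal, Fin.prod_univ_three]
    simp only [Matrix.cons_val_zero, Matrix.cons_val_one, Matrix.cons_val, one_mul]
    ring
  have hσ0 : σ ≠ 0 := by rintro rfl; norm_num at hσσ
  obtain ⟨z, hz, hz0, hz1, hz2, hz3⟩ := exists_int_mulVec_mem_hexagonalPrism (D * M)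
    (by rw [hdet]; positivity)
    (by
      rw [hdet, abs_mul, abs_mul, hσa, abs_of_pos (by positivity), one_mul, ← mul_inv,
        inv_mul_lt_iff₀ (by positivity)]
      linarith)
  have hv : ∀ i, ((D * M) *ᵥ fun i => (z i : ℝ)) i =
      ![1, P⁻¹, σ * R⁻¹] i * (M *ᵥ fun i => (z i : ℝ)) i := by
    intro i
    rw [← Matrix.mulVec_mulVec, hD, Matrix.mulVec_diagonal]
  refine ⟨z, hz, ?_⟩
  generalize (M *ᵥ fun i => (z i : ℝ)) = w at *
  simp only [hv] at hz0 hz1 hz2 hz3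
  simp only [Matrix.cons_val_zero, Matrix.cons_val_one, Matrix.cons_val, one_mul]
    at hz0 hz1 hz2 hz3
  have key := abs_mul_sub_mul_le (α := α * P) (β := σ * β * R) (C := C)
    (by
      have : α * P * (σ * β * R) = α * (σ * β) * (P * R) := by ring
      rw [this]; positivity)
    (by rwa [abs_mul, abs_of_pos hP]) (by rwa [abs_mul, abs_mul, hσa, one_mul, abs_of_pos hR])
    hz1 hz2 hz3
  refine ⟨hz0, ?_, ?_, ?_⟩
  · rwa [abs_mul, abs_of_pos (by positivity), inv_mul_le_iff₀ hP, mul_one] at hz1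
  · rwa [abs_mul, abs_mul, hσa, one_mul, abs_of_pos (by positivity), inv_mul_le_iff₀ hR,
      mul_one] at hz2
  · convert key using 2
    have : σ * β * R * (σ * R⁻¹ * w 2) = (σ * σ) * (R * R⁻¹) * (β * w 2) := by ring
    rw [this, hσσ, mul_inv_cancel₀ hR.ne']
    field_simp

/-! ### Approximability in coordinates. -/

theorem uniformlyApproximable_row_iff {Θ : Matrix (Fin 1) (Fin 2) ℝ} {ψ : ℝ → ℝ} :
    UniformlyApproximable Θ ψ ↔ ∀ᶠ t : ℝ in atTop, ∃ x₁ x₂ y : ℤ, (x₁ ≠ 0 ∨ x₂ ≠ 0) ∧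
      |(x₁ : ℝ)| ≤ t ∧ |(x₂ : ℝ)| ≤ t ∧ |Θ 0 0 * x₁ + Θ 0 1 * x₂ - y| ≤ ψ t := by
  refine eventually_congr (Eventually.of_forall fun t => ⟨?_, ?_⟩)
  · rintro ⟨x, y, h0, h1, h2⟩
    rw [pi_norm_le_iff_of_nonempty] at h1 h2
    refine ⟨x 0, x 1, y 0, ?_, h1 0, h1 1, ?_⟩
    · by_contra! h
      rw [norm_pos_iff] at h0
      refine h0 (funext fun i => ?_)
      fin_cases i <;> simp [h.1, h.2]
    · simpa [Matrix.mulVec, dotProduct, Fin.sum_univ_two] using h2 0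
  · rintro ⟨x₁, x₂, y, h0, h1, h2, h3⟩
    refine ⟨![x₁, x₂], ![y], ?_, ?_, ?_⟩
    · rw [norm_pos_iff]
      intro h
      have e0 := congrFun h 0
      have e1 := congrFun h 1
      simp at e0 e1
      tauto
    · rw [pi_norm_le_iff_of_nonempty]
      intro i
      fin_cases i <;> simpa
    · rw [pi_norm_le_iff_of_nonempty]
      intro i
      fin_cases i
      simpa [Matrix.mulVec, dotProduct, Fin.sum_univ_two] using h3

theorem uniformlyApproximable_column_iff {Θ : Matrix (Fin 1) (Fin 2) ℝ} {ψ : ℝ → ℝ} :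
    UniformlyApproximable Θᵀ ψ ↔ ∀ᶠ t : ℝ in atTop, ∃ q p₁ p₂ : ℤ, q ≠ 0 ∧
      |(q : ℝ)| ≤ t ∧ |Θ 0 0 * q - p₁| ≤ ψ t ∧ |Θ 0 1 * q - p₂| ≤ ψ t := by
  refine eventually_congr (Eventually.of_forall fun t => ⟨?_, ?_⟩)
  · rintro ⟨x, y, h0, h1, h2⟩
    rw [pi_norm_le_iff_of_nonempty] at h1 h2
    refine ⟨x 0, y 0, y 1, ?_, h1 0, ?_, ?_⟩
    · intro h
      rw [norm_pos_iff] at h0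
      refine h0 (funext fun i => ?_)
      fin_cases i; simp [h]
    · simpa [Matrix.mulVec, dotProduct] using h2 0
    · simpa [Matrix.mulVec, dotProduct] using h2 1
  · rintro ⟨q, p₁, p₂, h0, h1, h2, h3⟩
    refine ⟨![q], ![p₁, p₂], ?_, ?_, ?_⟩
    · rw [norm_pos_iff]
      intro h
      have e0 := congrFun h 0
      simp at e0
      exact h0 e0
    · rw [pi_norm_le_iff_of_nonempty]
      intro i
      fin_cases i; simpa
    · rw [pi_norm_le_iff_of_nonempty]
      intro i
      fin_cases i
      · simpa [Matrix.mulVec, dotProduct] using h2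
      · simpa [Matrix.mulVec, dotProduct] using h3

/-! ### Dual vectors on the plane orthogonal to one approximation. -/

theorem int_eq_zero_of_abs_cast_lt_one {n : ℤ} (h : |(n : ℝ)| < 1) : n = 0 := by
  rw [← Int.abs_lt_one_iff]
  exact_mod_cast h

/-- Integer points do not notice a small enlargement of an interval. -/
theorem exists_gt_forall_int_abs_le (Q : ℝ) :
    ∃ Q' > Q, ∀ Q'' ≤ Q', ∀ n : ℤ, |(n : ℝ)| ≤ Q'' → |(n : ℝ)| ≤ Q := by
  refine ⟨(Q + (⌊Q⌋ + 1)) / 2, by linarith [Int.lt_floor_add_one Q], fun Q'' hQ n hn => ?_⟩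
  have h : |(n : ℝ)| < ⌊Q⌋ + 1 := by linarith [Int.lt_floor_add_one Q]
  have h2 : |n| ≤ ⌊Q⌋ := Int.lt_add_one_iff.1 (by exact_mod_cast h)
  exact le_trans (by exact_mod_cast h2) (Int.floor_le Q)

/-- Only two of the three forms need enter Minkowski's theorem: on the plane `x₁ p₁ + x₂ p₂ = y q`
one has `x₁ (a q - p₁) = (a x₁ + b x₂ - y) q - x₂ (b q - p₂)`. Dividing by the larger coordinate
`x₁` keeps the last coefficient at most 1. -/
theorem exists_simultaneous_of_abs_le (a b : ℝ) {x₁ x₂ y : ℤ} {Q U : ℝ}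
    (h21 : |(x₂ : ℝ)| ≤ |(x₁ : ℝ)|) (hx : x₁ ≠ 0) (hQ : 0 < Q) (hU : 0 < U)
    (h1 : |a * x₁ + b * x₂ - y| * Q ≤ |(x₁ : ℝ)| * U) (h2 : 4 * |(x₁ : ℝ)| < 3 * (Q * U)) :
    ∃ q p₁ p₂ : ℤ, (q ≠ 0 ∨ p₁ ≠ 0 ∨ p₂ ≠ 0) ∧ |(q : ℝ)| ≤ Q ∧ |a * q - p₁| ≤ U ∧
      |b * q - p₂| ≤ U := by
  have hx' : (x₁ : ℝ) ≠ 0 := by exact_mod_cast hx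
  have hdet : (!![-(y : ℝ), x₁, x₂; 1, 0, 0; b, 0, -1]).det = x₁ := by
    rw [Matrix.det_fin_three]; simp
  obtain ⟨z, hz, z0, z1, z2, z3⟩ := exists_int_forms_le
    !![-(y : ℝ), x₁, x₂; 1, 0, 0; b, 0, -1] (P := Q) (R := U) (α := a * x₁ + b * x₂ - y)
    (β := x₂) (C := |(x₁ : ℝ)| * U) hQ hU h1 (by gcongr) (by rwa [hdet]) (by rwa [hdet])
  simp [Matrix.mulVec, dotProduct, Fin.sum_univ_three] at z0 z1 z2 z3
  have hh : -y * z 0 + x₁ * z 1 + x₂ * z 2 = 0 :=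
    int_eq_zero_of_abs_cast_lt_one (by push_cast; convert z0 using 2; ring)
  have hh' : -(y : ℝ) * z 0 + x₁ * z 1 + x₂ * z 2 = 0 := by exact_mod_cast hh
  refine ⟨z 0, z 1, z 2, ?_, z1, ?_, by rwa [sub_eq_add_neg]⟩
  · by_contra! h
    refine hz (funext fun i => ?_)
    fin_cases i
    exacts [h.1, h.2.1, h.2.2]
  · refine le_of_mul_le_mul_left ?_ (abs_pos.2 hx')
    have e : (x₁ : ℝ) * (a * z 0 - z 1) =
        (a * x₁ + b * x₂ - y) * z 0 - x₂ * (b * z 0 + -z 2) := by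
      linear_combination -hh'
    rwa [← abs_mul, e]

/-- A good integer point of a linear form in two variables gives a good simultaneous
approximation to its coefficients. -/
theorem exists_simultaneous (a b : ℝ) {x₁ x₂ y : ℤ} {Q U X : ℝ} (hx : x₁ ≠ 0 ∨ x₂ ≠ 0)
    (hX : X = max |(x₁ : ℝ)| |(x₂ : ℝ)|) (hQ : 0 < Q) (hU : 0 < U)
    (h1 : |a * x₁ + b * x₂ - y| * Q < X * U) (h2 : 4 * X ≤ 3 * (Q * U)) :
    ∃ q p₁ p₂ : ℤ, (q ≠ 0 ∨ p₁ ≠ 0 ∨ p₂ ≠ 0) ∧ |(q : ℝ)| ≤ Q ∧ |a * q - p₁| ≤ U ∧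
      |b * q - p₂| ≤ U := by
  obtain ⟨Q₁, hQ₁, hint⟩ := exists_gt_forall_int_abs_le Q
  -- Minkowski needs a strict volume bound, so `Q` is widened. The strictness of `h1` leaves room
  -- for this; if the error vanishes, any widening is harmless.
  obtain ⟨Q₂, hQ₂, hQ₂₁, h1'⟩ :
      ∃ Q₂ > Q, Q₂ ≤ Q₁ ∧ |a * x₁ + b * x₂ - y| * Q₂ ≤ X * U := by
    rcases (abs_nonneg (a * x₁ + b * x₂ - y)).eq_or_lt with h | h
    · refine ⟨Q₁, hQ₁, le_rfl, ?_⟩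
      rw [← h] at h1 ⊢
      linarith
    · refine ⟨min Q₁ (X * U / |a * x₁ + b * x₂ - y|), lt_min hQ₁ ?_, min_le_left _ _, ?_⟩
      · rwa [lt_div_iff₀ h, mul_comm]
      · rw [mul_comm, ← le_div_iff₀ h]
        exact min_le_right _ _
  have h2' : 4 * X < 3 * (Q₂ * U) := by nlinarith
  have hQ₂0 : 0 < Q₂ := hQ.trans hQ₂
  rcases le_total |(x₂ : ℝ)| |(x₁ : ℝ)| with h | h
  · rw [max_eq_left h] at hX
    subst hX
    obtain ⟨q, p₁, p₂, g0, g1, g2, g3⟩ := exists_simultaneous_of_abs_le a b h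
      (by
        rintro rfl
        simp at h
        tauto) hQ₂0 hU h1' h2'
    exact ⟨q, p₁, p₂, g0, hint _ hQ₂₁ _ g1, g2, g3⟩
  · rw [max_eq_right h] at hX
    subst hX
    rw [add_comm (a * (x₁ : ℝ))] at h1'
    obtain ⟨q, p₂, p₁, g0, g1, g2, g3⟩ := exists_simultaneous_of_abs_le b a h
      (by
        rintro rfl
        simp at h
        tauto) hQ₂0 hU h1' h2'
    exact ⟨q, p₁, p₂, by tauto, hint _ hQ₂₁ _ g1, g3, g2⟩

/-- On the plane `p₁ x₁ + p₂ x₂ = q y` one has `(a q - p₁) x₁ = q (a x₁ + b x₂ - y) - (b q - p₂)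
x₂`, so the bound on `x₁` is the third strip. -/
theorem exists_linear_form_of_abs_le (a b : ℝ) {q p₁ p₂ : ℤ} {Z l : ℝ}
    (h21 : |b * q - p₂| ≤ |a * q - p₁|) (hA : 0 < |a * q - p₁|) (hZ : 0 < Z) (hl : 0 < l)
    (h1 : |(q : ℝ)| * l ≤ |a * q - p₁| * Z) (h2 : 4 * |a * q - p₁| < 3 * (l * Z)) :
    ∃ x₁ x₂ y : ℤ, (x₁ ≠ 0 ∨ x₂ ≠ 0 ∨ y ≠ 0) ∧ |(x₁ : ℝ)| ≤ Z ∧ |(x₂ : ℝ)| ≤ Z ∧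
      |a * x₁ + b * x₂ - y| ≤ l := by
  have hdet : (!![(p₁ : ℝ), p₂, -q; a, b, -1; 0, 1, 0]).det = -(a * q - p₁) := by
    rw [Matrix.det_fin_three]; simp; ring
  obtain ⟨z, hz, z0, z1, z2, z3⟩ := exists_int_forms_le
    !![(p₁ : ℝ), p₂, -q; a, b, -1; 0, 1, 0] (P := l) (R := Z) (α := q)
    (β := b * q - p₂) (C := |a * q - p₁| * Z) hl hZ h1 (by gcongr)
    (by rw [hdet, neg_ne_zero]; exact abs_pos.1 hA) (by rwa [hdet, abs_neg])
  simp [Matrix.mulVec, dotProduct, Fin.sum_univ_three] at z0 z1 z2 z3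
  have hh : p₁ * z 0 + p₂ * z 1 - q * z 2 = 0 :=
    int_eq_zero_of_abs_cast_lt_one (by push_cast; rwa [sub_eq_add_neg])
  have hh' : (p₁ : ℝ) * z 0 + p₂ * z 1 - q * z 2 = 0 := by exact_mod_cast hh
  refine ⟨z 0, z 1, z 2, ?_, ?_, z2, by rwa [sub_eq_add_neg]⟩
  · by_contra! h
    refine hz (funext fun i => ?_)
    fin_cases i
    exacts [h.1, h.2.1, h.2.2]
  · refine le_of_mul_le_mul_left ?_ hA
    have e : (a * q - p₁) * z 0 =
        q * (a * z 0 + b * z 1 + -z 2) - (b * q - p₂) * z 1 := by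
      linear_combination -hh'
    rwa [← abs_mul, e]

/-- A good simultaneous approximation to two numbers gives a good integer point of the linear form
with these coefficients. -/
theorem exists_linear_form (a b : ℝ) {q p₁ p₂ : ℤ} {Z l A : ℝ}
    (hA : A = max |a * q - p₁| |b * q - p₂|) (hA0 : 0 < A) (hZ : 0 < Z) (hl : 0 < l)
    (h1 : |(q : ℝ)| * l ≤ A * Z) (h2 : 4 * A ≤ 3 * (l * Z)) :
    ∃ x₁ x₂ y : ℤ, (x₁ ≠ 0 ∨ x₂ ≠ 0 ∨ y ≠ 0) ∧ |(x₁ : ℝ)| ≤ Z ∧ |(x₂ : ℝ)| ≤ Z ∧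
      |a * x₁ + b * x₂ - y| ≤ l := by
  obtain ⟨Z', hZ', hint⟩ := exists_gt_forall_int_abs_le Z
  have h1' : |(q : ℝ)| * l ≤ A * Z' := h1.trans (by gcongr)
  have h2' : 4 * A < 3 * (l * Z') := by nlinarith
  have hZ'0 : 0 < Z' := hZ.trans hZ'
  rcases le_total |b * q - p₂| |a * q - p₁| with h | h
  · rw [max_eq_left h] at hA
    subst hA
    obtain ⟨x₁, x₂, y, g0, g1, g2, g3⟩ :=
      exists_linear_form_of_abs_le a b h hA0 hZ'0 hl h1' h2'
    exact ⟨x₁, x₂, y, g0, hint _ le_rfl _ g1, hint _ le_rfl _ g2, g3⟩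
  · rw [max_eq_right h] at hA
    subst hA
    obtain ⟨x₂, x₁, y, g0, g1, g2, g3⟩ :=
      exists_linear_form_of_abs_le b a h hA0 hZ'0 hl h1' h2'
    exact ⟨x₁, x₂, y, by tauto, hint _ le_rfl _ g2, hint _ le_rfl _ g1, by rwa [add_comm (a * _)]⟩

/-! ### Best approximations and their neighbours. -/

theorem exists_linear_form_min (a b : ℝ) {s : ℝ} (hs : 1 ≤ s) :
    ∃ x₁ x₂ y : ℤ, (x₁ ≠ 0 ∨ x₂ ≠ 0) ∧ |(x₁ : ℝ)| ≤ s ∧ |(x₂ : ℝ)| ≤ s ∧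
      ∀ x₁' x₂' y' : ℤ, (x₁' ≠ 0 ∨ x₂' ≠ 0) → |(x₁' : ℝ)| ≤ s → |(x₂' : ℝ)| ≤ s →
        |a * x₁ + b * x₂ - y| ≤ |a * x₁' + b * x₂' - y'| := by
  have hmem : ∀ n : ℤ, n ∈ Finset.Icc (-⌊s⌋) ⌊s⌋ ↔ |(n : ℝ)| ≤ s := by
    intro n
    rw [Finset.mem_Icc, ← abs_le, Int.le_floor, Int.cast_abs]
  obtain ⟨⟨x₁, x₂⟩, hx, hmin⟩ := Finset.exists_min_image
    (((Finset.Icc (-⌊s⌋) ⌊s⌋) ×ˢ (Finset.Icc (-⌊s⌋) ⌊s⌋)).filter fun x => x.1 ≠ 0 ∨ x.2 ≠ 0)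
    (fun x => |a * x.1 + b * x.2 - round (a * x.1 + b * x.2)|)
    ⟨(1, 0), by
      simp only [Finset.mem_filter, Finset.mem_product, hmem]
      norm_num
      exact ⟨hs, by linarith⟩⟩
  simp only [Finset.mem_filter, Finset.mem_product, hmem] at hx hmin
  refine ⟨x₁, x₂, round (a * x₁ + b * x₂), hx.2, hx.1.1, hx.1.2, fun x₁' x₂' y' h0 h1 h2 => ?_⟩
  exact (hmin (x₁', x₂') ⟨⟨h1, h2⟩, h0⟩).trans (round_le _ _)

theorem exists_simultaneous_min (a b : ℝ) {s : ℝ} (hs : 1 ≤ s) :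
    ∃ q p₁ p₂ : ℤ, q ≠ 0 ∧ |(q : ℝ)| ≤ s ∧
      ∀ q' p₁' p₂' : ℤ, q' ≠ 0 → |(q' : ℝ)| ≤ s →
        max |a * q - p₁| |b * q - p₂| ≤ max |a * q' - p₁'| |b * q' - p₂'| := by
  have hmem : ∀ n : ℤ, n ∈ Finset.Icc (-⌊s⌋) ⌊s⌋ ↔ |(n : ℝ)| ≤ s := by
    intro n
    rw [Finset.mem_Icc, ← abs_le, Int.le_floor, Int.cast_abs]
  obtain ⟨q, hq, hmin⟩ := Finset.exists_min_image
    ((Finset.Icc (-⌊s⌋) ⌊s⌋).filter fun q => q ≠ 0)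
    (fun q => max |a * q - round (a * q)| |b * q - round (b * q)|)
    ⟨1, by
      simp only [Finset.mem_filter, hmem]
      norm_num
      exact hs⟩
  simp only [Finset.mem_filter, hmem] at hq hmin
  refine ⟨q, round (a * q), round (b * q), hq.2, hq.1, fun q' p₁' p₂' h0 h1 => ?_⟩
  exact (hmin q' ⟨h1, h0⟩).trans (max_le_max (round_le _ _) (round_le _ _))

/-- Passage to the limit `T → Y`: the minimality of a best approximation controls only scales
strictly below the height of the next. -/
theorem mul_le_of_forall_mul_le_of_lt {c T₀ Y F : ℝ} (hc : 0 < c) (hT : T₀ < Y)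
    (h : ∀ T, T₀ ≤ T → T < Y → c * T ≤ F) : c * Y ≤ F := by
  by_contra! hlt
  have : max T₀ (F / c) < Y := max_lt hT (by rwa [div_lt_iff₀ hc, mul_comm])
  obtain ⟨T, h1, h2⟩ := exists_between this
  have h3 := h T ((le_max_left _ _).trans h1.le) h2
  have h4 := (le_max_right _ _).trans_lt h1
  rw [div_lt_iff₀ hc, mul_comm] at h4
  linarith

/-- One scale of the transference from a linear form to simultaneous approximation. -/
theorem exists_simultaneous_of_uniform (a b : ℝ) {ψ : ℝ → ℝ} {T₀ s : ℝ}
    (hpos : ∀ t, 0 < t → 0 < ψ t) (hlim : ∀ c > 0, ∃ S, ∀ t ≥ S, ψ t ≤ c)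
    (hf : AntitoneOn (fun t => t * ψ t) (Ioi 0))
    (happ : ∀ t ≥ T₀, ∃ x₁ x₂ y : ℤ, (x₁ ≠ 0 ∨ x₂ ≠ 0) ∧
      |(x₁ : ℝ)| ≤ t ∧ |(x₂ : ℝ)| ≤ t ∧ |a * x₁ + b * x₂ - y| ≤ ψ t)
    (hT : T₀ ≤ s) (hs : 1 ≤ s) (hfs : 2 * (s * ψ s) < 1) :
    ∃ q p₁ p₂ : ℤ, q ≠ 0 ∧ |(q : ℝ)| ≤ 2 / (3 * ψ s) ∧ |a * q - p₁| ≤ 2 * (s * ψ s) ∧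
      |b * q - p₂| ≤ 2 * (s * ψ s) := by
  have hs0 : 0 < s := by linarith
  have hψ := hpos s hs0
  suffices H : ∃ q p₁ p₂ : ℤ, (q ≠ 0 ∨ p₁ ≠ 0 ∨ p₂ ≠ 0) ∧ |(q : ℝ)| ≤ 2 / (3 * ψ s) ∧
      |a * q - p₁| ≤ 2 * (s * ψ s) ∧ |b * q - p₂| ≤ 2 * (s * ψ s) by
    obtain ⟨q, p₁, p₂, h0, h1, h2, h3⟩ := H
    refine ⟨q, p₁, p₂, ?_, h1, h2, h3⟩
    rintro rfl
    have e1 : p₁ = 0 := int_eq_zero_of_abs_cast_lt_one (by simpa using h2.trans_lt hfs)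
    have e2 : p₂ = 0 := int_eq_zero_of_abs_cast_lt_one (by simpa using h3.trans_lt hfs)
    tauto
  obtain ⟨x₁, x₂, y, hx, hx1, hx2, hmin⟩ := exists_linear_form_min a b hs
  set L := a * x₁ + b * x₂ - y with hL
  set X := max |(x₁ : ℝ)| |(x₂ : ℝ)| with hX
  have hX0 : 0 < X := by
    rcases hx with h | h
    · exact lt_max_of_lt_left (abs_pos.2 (by exact_mod_cast h))
    · exact lt_max_of_lt_right (abs_pos.2 (by exact_mod_cast h))
  have hXs : X ≤ s := max_le hx1 hx2
  have hQU : 4 * X ≤ 3 * (2 / (3 * ψ s) * (2 * (s * ψ s))) := by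
    have : 3 * (2 / (3 * ψ s) * (2 * (s * ψ s))) = 4 * s := by field_simp; ring
    linarith
  by_cases hcase : |L| * (2 / (3 * ψ s)) < X * (2 * (s * ψ s))
  · exact exists_simultaneous a b hx hX (by positivity) (by positivity) hcase hQU
  have hL0 : 0 < |L| := by
    by_contra! h
    have h' : |L| = 0 := le_antisymm h (abs_nonneg _)
    rw [h', zero_mul] at hcase
    exact hcase (by positivity)
  -- The least such `n` is the height of the next best approximation.
  have hex : ∃ n : ℕ, ∃ x₁' x₂' y' : ℤ, (x₁' ≠ 0 ∨ x₂' ≠ 0) ∧ |(x₁' : ℝ)| ≤ n ∧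
      |(x₂' : ℝ)| ≤ n ∧ |a * x₁' + b * x₂' - y'| < |L| := by
    obtain ⟨S, hS⟩ := hlim (|L| / 2) (by positivity)
    obtain ⟨x₁', x₂', y', h0, h1, h2, h3⟩ := happ (max S T₀) (le_max_right _ _)
    have := Nat.le_ceil (max S T₀)
    exact ⟨⌈max S T₀⌉₊, x₁', x₂', y', h0, h1.trans this, h2.trans this,
      by linarith [hS _ (le_max_left S T₀)]⟩
  classical
  obtain ⟨x₁', x₂', y', h0', h1', h2', hL'⟩ := Nat.find_spec hex
  have hlow := fun m => Nat.find_min hex (m := m)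
  set N := Nat.find hex
  set L' := a * x₁' + b * x₂' - y' with hLL'
  have hbig : s < |(x₁' : ℝ)| ∨ s < |(x₂' : ℝ)| := by
    by_contra! h
    exact absurd (hmin x₁' x₂' y' h0' h.1 h.2) (not_le.2 hL')
  have hsN : s < N := by
    rcases hbig with h | h
    · exact h.trans_le h1'
    · exact h.trans_le h2'
  have hLN : |L| * N ≤ s * ψ s := by
    refine mul_le_of_forall_mul_le_of_lt hL0 hsN fun T hsT hTN => ?_
    have hT0 : 0 < T := by linarith
    obtain ⟨u₁, u₂, v, g0, g1, g2, g3⟩ := happ T (hT.trans hsT)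
    have hle : |L| ≤ |a * u₁ + b * u₂ - v| := by
      by_contra! hlt
      refine hlow ⌊T⌋₊ ((Nat.floor_lt hT0.le).2 hTN) ⟨u₁, u₂, v, g0, ?_, ?_, hlt⟩ <;>
      · rw [← Int.cast_abs, ← Int.cast_natCast, Int.cast_le, Int.natCast_floor_eq_floor hT0.le,
          Int.le_floor]
        simpa
    have := hf (mem_Ioi.2 hs0) (mem_Ioi.2 hT0) hsT
    simp only at this
    nlinarith [mul_le_mul_of_nonneg_right (hle.trans g3) hT0.le]
  have hN0 : (0 : ℝ) < N := by linarith
  have hx1X : |(x₁ : ℝ)| ≤ X := le_max_left _ _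
  have hx2X : |(x₂ : ℝ)| ≤ X := le_max_right _ _
  -- Negating `hcase` gives `|L| ≥ 3 X s (ψ s)²`; combined with `hLN` this bounds `X * N` by `1 / (3
  -- ψ s)`.
  have hXN : 2 * (X * N) ≤ 2 / (3 * ψ s) := by
    rw [le_div_iff₀ (by positivity)]
    by_contra! hlt
    apply hcase
    rw [mul_div_assoc', div_lt_iff₀ (by positivity)]
    have k1 : |L| * N * 1 < (s * ψ s) * (3 * (X * N) * ψ s) :=
      mul_lt_mul' hLN (by linarith) (by norm_num) (by positivity)
    have k2 : |L| < s * ψ s * (3 * X * ψ s) := by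
      refine lt_of_mul_lt_mul_right ?_ hN0.le
      calc |L| * N = |L| * N * 1 := by ring
        _ < _ := k1
        _ = _ := by ring
    nlinarith
  have hbound : ∀ c c' : ℝ, |c| ≤ X → |c'| ≤ N → |L * c' - L' * c| ≤ 2 * (s * ψ s) := by
    intro c c' hc hc'
    have e1 : |L * c'| ≤ |L| * N := by rw [abs_mul]; gcongr
    have e2 : |L' * c| ≤ |L| * N := by
      rw [abs_mul]
      exact mul_le_mul hL'.le (by linarith) (abs_nonneg _) hL0.le
    linarith [abs_sub (L * c') (L' * c)]
  -- Cross product, up to sign and order of coordinates, of the two best approximations. It cannot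
  -- vanish, since the second is strictly higher and has strictly smaller error.
  refine ⟨x₁ * x₂' - x₂ * x₁', y * x₂' - y' * x₂, x₁ * y' - x₁' * y, ?_, ?_, ?_, ?_⟩
  · by_contra! h
    obtain ⟨g0, g1, g2⟩ := h
    have g0' : (x₁ : ℝ) * x₂' - x₂ * x₁' = 0 := by exact_mod_cast g0
    have g1' : (y : ℝ) * x₂' - y' * x₂ = 0 := by exact_mod_cast g1
    have g2' : (x₁ : ℝ) * y' - x₁' * y = 0 := by exact_mod_cast g2
    have k2 : L * x₂' = L' * x₂ := by
      rw [hL, hLL']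
      linear_combination a * g0' - g1'
    have k1 : L * x₁' = L' * x₁ := by
      rw [hL, hLL']
      linear_combination -b * g0' + g2'
    have hcontra : ∀ c c' : ℝ, |c| ≤ s → s < |c'| → L * c' ≠ L' * c := by
      intro c c' hc hc' he
      have he' := congrArg abs he
      rw [abs_mul, abs_mul] at he'
      have e1 : |L'| * |c| ≤ |L| * s := mul_le_mul hL'.le hc (abs_nonneg _) hL0.le
      have e2 : |L| * s < |L| * |c'| := by gcongr
      linarith
    rcases hbig with h | h
    · exact hcontra _ _ hx1 h k1
    · exact hcontra _ _ hx2 h k2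
  · push_cast
    refine le_trans ?_ hXN
    have e1 : |(x₁ : ℝ) * x₂'| ≤ X * N := by rw [abs_mul]; gcongr
    have e2 : |(x₂ : ℝ) * x₁'| ≤ X * N := by rw [abs_mul]; gcongr
    linarith [abs_sub ((x₁ : ℝ) * x₂') (x₂ * x₁')]
  · have := hbound x₂ x₂' hx2X h2'
    convert this using 2
    rw [hL, hLL']
    push_cast
    ring
  · have := hbound x₁ x₁' hx1X h1'
    rw [abs_sub_comm] at this
    convert this using 2
    rw [hL, hLL']
    push_cast
    ring

/-- One scale of the transference from simultaneous approximation to a linear form. -/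
theorem exists_linear_form_of_uniform (a b : ℝ) {ψ : ℝ → ℝ} {T s : ℝ}
    (hpos : ∀ t, 0 < t → 0 < ψ t) (hf : MonotoneOn (fun t => t * ψ t) (Ioi 0))
    (happ : ∀ t ≥ T, ∃ q p₁ p₂ : ℤ, q ≠ 0 ∧ |(q : ℝ)| ≤ t ∧ |a * q - p₁| ≤ ψ t ∧
      |b * q - p₂| ≤ ψ t)
    (hirr : ∀ q p₁ p₂ : ℤ, q ≠ 0 → 0 < max |a * q - p₁| |b * q - p₂|)
    (hT : 1 ≤ T) (hs : T ≤ s)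
    (hlow : ∀ q p₁ p₂ : ℤ, q ≠ 0 → |(q : ℝ)| ≤ T → ψ s < max |a * q - p₁| |b * q - p₂|) :
    ∃ x₁ x₂ y : ℤ, (x₁ ≠ 0 ∨ x₂ ≠ 0) ∧ |(x₁ : ℝ)| ≤ 2 * (s * ψ s) ∧
      |(x₂ : ℝ)| ≤ 2 * (s * ψ s) ∧ |a * x₁ + b * x₂ - y| ≤ 2 / (3 * s) := by
  have hs0 : 0 < s := by linarith
  have hψ := hpos s hs0
  suffices H : ∃ x₁ x₂ y : ℤ, (x₁ ≠ 0 ∨ x₂ ≠ 0 ∨ y ≠ 0) ∧ |(x₁ : ℝ)| ≤ 2 * (s * ψ s) ∧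
      |(x₂ : ℝ)| ≤ 2 * (s * ψ s) ∧ |a * x₁ + b * x₂ - y| ≤ 2 / (3 * s) by
    obtain ⟨x₁, x₂, y, h0, h1, h2, h3⟩ := H
    refine ⟨x₁, x₂, y, ?_, h1, h2, h3⟩
    by_contra! h
    obtain ⟨rfl, rfl⟩ := h
    have hl : 2 / (3 * s) < 1 := by
      rw [div_lt_one (by positivity)]
      linarith
    have : y = 0 := int_eq_zero_of_abs_cast_lt_one (by simpa using h3.trans_lt hl)
    tauto
  obtain ⟨q, p₁, p₂, hq, hqs, hmin⟩ := exists_simultaneous_min a b (hT.trans hs)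
  set A := max |a * q - p₁| |b * q - p₂| with hA
  have hA0 : 0 < A := hirr q p₁ p₂ hq
  have hAψ : A ≤ ψ s := by
    obtain ⟨r, t₁, t₂, h0, h1, h2, h3⟩ := happ s hs
    exact (hmin r t₁ t₂ h0 h1).trans (max_le h2 h3)
  by_cases hcase : |(q : ℝ)| * (2 / (3 * s)) ≤ A * (2 * (s * ψ s))
  · refine exists_linear_form a b hA hA0 (by positivity) (by positivity) hcase ?_
    have : 3 * (2 / (3 * s) * (2 * (s * ψ s))) = 4 * ψ s := by field_simp; ring
    linarith
  -- This makes `happ` available at scales just below `|q|`.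
  have hTq : T < |(q : ℝ)| := by
    by_contra! h
    exact absurd hAψ (not_le.2 (hlow q p₁ p₂ hq h))
  have hpred : ∀ r : ℤ, |(r : ℝ)| < |(q : ℝ)| → |(r : ℝ)| ≤ |(q : ℝ)| - 1 := by
    intro r hr
    have h : |r| < |q| := by exact_mod_cast hr
    have h' : |r| ≤ |q| - 1 := by omega
    exact_mod_cast h'
  have hq2 : 1 ≤ |(q : ℝ)| - 1 := by
    simpa using hpred 1 (by simpa using hT.trans_lt hTq)
  obtain ⟨q', p₁', p₂', hq', hqq, hmin'⟩ := exists_simultaneous_min a b hq2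
  set A' := max |a * q' - p₁'| |b * q' - p₂'| with hA'
  have hAA : A ≤ A' := hmin q' p₁' p₂' hq' (by linarith)
  have hA'0 : 0 < A' := hirr q' p₁' p₂' hq'
  -- At scales `t` in `[T, |q|)` every admissible denominator is at most `|q| - 1`, so `A' ≤ ψ t`.
  have hA'q : A' * |(q : ℝ)| ≤ s * ψ s := by
    refine mul_le_of_forall_mul_le_of_lt hA'0 hTq fun t hTt htq => ?_
    have ht0 : 0 < t := by linarith
    obtain ⟨r, t₁, t₂, h0, h1, h2, h3⟩ := happ t hTt
    have hle : A' ≤ ψ t :=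
      (hmin' r t₁ t₂ h0 (hpred r (h1.trans_lt htq))).trans (max_le h2 h3)
    have := hf (mem_Ioi.2 ht0) (mem_Ioi.2 hs0) (htq.le.trans hqs)
    simp only at this
    nlinarith [mul_le_mul_of_nonneg_right hle ht0.le]
  -- Negating `hcase` gives `3 s A (s ψ s) < |q|`; multiply by `A'` and use `hA'q`.
  have hprod : 2 * (A * A') ≤ 2 / (3 * s) := by
    rw [le_div_iff₀ (by positivity)]
    rw [not_le, mul_div_assoc', lt_div_iff₀ (by positivity)] at hcase
    have h1 := mul_lt_mul_of_pos_right hcase hA'0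
    have h2 : 3 * s * (A * A') * (s * ψ s) < 1 * (s * ψ s) := by nlinarith
    have h3 := lt_of_mul_lt_mul_right h2 (by positivity)
    linarith
  have ha : |a * q - p₁| ≤ A := le_max_left _ _
  have hb : |b * q - p₂| ≤ A := le_max_right _ _
  have ha' : |a * q' - p₁'| ≤ A' := le_max_left _ _
  have hb' : |b * q' - p₂'| ≤ A' := le_max_right _ _
  have hqlt : |(q' : ℝ)| < |(q : ℝ)| := by linarith
  have hbound : ∀ c c' : ℝ, |c| ≤ A → |c'| ≤ A' → |q' * c - q * c'| ≤ 2 * (s * ψ s) := by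
    intro c c' hc hc'
    have e1 : |q' * c| ≤ |(q : ℝ)| * A' := by
      rw [abs_mul]
      exact mul_le_mul hqlt.le (hc.trans hAA) (abs_nonneg _) (abs_nonneg _)
    have e2 : |q * c'| ≤ |(q : ℝ)| * A' := by rw [abs_mul]; gcongr
    linarith [abs_sub (q' * c) (q * c')]
  refine ⟨q' * p₂ - q * p₂', q * p₁' - q' * p₁, p₁' * p₂ - p₁ * p₂', ?_, ?_, ?_, ?_⟩
  · by_contra! h
    obtain ⟨g1, g2, -⟩ := h
    have g1' : (q' : ℝ) * p₂ - q * p₂' = 0 := by exact_mod_cast g1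
    have g2' : (q : ℝ) * p₁' - q' * p₁ = 0 := by exact_mod_cast g2
    have hlt : ∀ c c' : ℝ, |c| ≤ A → q * c' = q' * c → |q| * |c'| ≤ |(q' : ℝ)| * A := by
      intro c c' hc he
      have he' := congrArg abs he
      rw [abs_mul, abs_mul] at he'
      rw [Int.cast_abs, he']
      gcongr
    have k1 := hlt _ (a * q' - p₁') ha (by linear_combination -g2')
    have k2 := hlt _ (b * q' - p₂') hb (by linear_combination g1')
    have k3 : |(q : ℝ)| * A' ≤ |(q' : ℝ)| * A := by
      rw [Int.cast_abs] at k1 k2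
      rw [hA', mul_max_of_nonneg _ _ (abs_nonneg _)]
      exact max_le k1 k2
    nlinarith [abs_nonneg (q' : ℝ)]
  · have := hbound _ _ hb hb'
    rw [abs_sub_comm] at this
    convert this using 2
    push_cast
    ring
  · have := hbound _ _ ha ha'
    convert this using 2
    push_cast
    ring
  · refine le_trans ?_ hprod
    have e1 : |(a * q - p₁) * (b * q' - p₂')| ≤ A * A' := by rw [abs_mul]; gcongr
    have e2 : |(b * q - p₂) * (a * q' - p₁')| ≤ A * A' := by rw [abs_mul]; gcongr
    -- The linear form at the cross product is the 2×2 determinant of the approximation errors.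
    have e3 := abs_sub ((a * q - p₁) * (b * q' - p₂')) ((b * q - p₂) * (a * q' - p₁'))
    have e4 : (a : ℝ) * ((q' * p₂ - q * p₂' : ℤ) : ℝ) + b * ((q * p₁' - q' * p₁ : ℤ) : ℝ) -
        ((p₁' * p₂ - p₁ * p₂' : ℤ) : ℝ) =
        (a * q - p₁) * (b * q' - p₂') - (b * q - p₂) * (a * q' - p₁') := by
      push_cast
      ring
    rw [e4]
    linarith

/-! ### Inverse functions and the choice of scale. -/

theorem PosInvertible.pos {g : ℝ → ℝ} (hg : PosInvertible g) {t : ℝ} (ht : 0 < t) : 0 < g t :=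
  hg.mapsTo ht

theorem AntitoneOn.exists_forall_ge_le {g : ℝ → ℝ} (h : AntitoneOn g (Ioi 0))
    (hg : PosInvertible g) {c : ℝ} (hc : 0 < c) : ∃ S > 0, ∀ t ≥ S, g t ≤ c := by
  obtain ⟨h1, h2, -⟩ := posInv_spec hg hc
  exact ⟨_, h1, fun t ht => (h h1 (h1.trans_le ht) ht).trans h2.le⟩

theorem AntitoneOn.eventually_le_posInv {g : ℝ → ℝ} (h : AntitoneOn g (Ioi 0))
    (hg : PosInvertible g) (S : ℝ) : ∀ᶠ t in atTop, S ≤ posInv g (2 / (3 * t)) := by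
  have hS : 0 < max S 1 := lt_max_of_lt_right one_pos
  have hgS := hg.pos hS
  filter_upwards [eventually_gt_atTop 0, eventually_gt_atTop (2 / (3 * g (max S 1)))]
    with t ht0 ht
  obtain ⟨h1, h2, -⟩ := posInv_spec hg (show 0 < 2 / (3 * t) by positivity)
  by_contra! hlt
  have h3 := h h1 hS (hlt.le.trans (le_max_left S 1))
  rw [h2, le_div_iff₀ (by positivity)] at h3
  rw [div_lt_iff₀ (by positivity)] at ht
  linarith

theorem MonotoneOn.eventually_le_posInv {g : ℝ → ℝ} (h : MonotoneOn g (Ioi 0))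
    (hg : PosInvertible g) (S : ℝ) : ∀ᶠ t in atTop, S ≤ posInv g (t / 2) := by
  have hS : 0 < max S 1 := lt_max_of_lt_right one_pos
  filter_upwards [eventually_gt_atTop 0, eventually_gt_atTop (2 * g (max S 1))] with t ht0 ht
  obtain ⟨h1, h2, -⟩ := posInv_spec hg (show 0 < t / 2 by positivity)
  by_contra! hlt
  have h3 := h h1 hS (hlt.le.trans (le_max_left S 1))
  rw [h2] at h3
  linarith

theorem uniformlyApproximable_transpose_of_antitoneOn {Θ : Matrix (Fin 1) (Fin 2) ℝ} {ψ : ℝ → ℝ}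
    (hψ : PosInvertible ψ) (hψ_dec : AntitoneOn ψ (Ioi 0))
    (hf : PosInvertible (fun t => t * ψ t)) (hf_dec : AntitoneOn (fun t => t * ψ t) (Ioi 0))
    (h : UniformlyApproximable Θ ψ) :
    UniformlyApproximable Θᵀ (fun t => 4 / (3 * t) * posInv ψ (2 / (3 * t))) := by
  rw [uniformlyApproximable_column_iff]
  rw [uniformlyApproximable_row_iff] at h
  obtain ⟨T₀, hT₀⟩ := eventually_atTop.1 h
  obtain ⟨S, -, hS⟩ := hf_dec.exists_forall_ge_le hf (show (0 : ℝ) < 1 / 4 by norm_num)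
  filter_upwards [eventually_gt_atTop 0, hψ_dec.eventually_le_posInv hψ T₀,
    hψ_dec.eventually_le_posInv hψ S, hψ_dec.eventually_le_posInv hψ 1] with t ht h1 h2 h3
  obtain ⟨-, hs, -⟩ := posInv_spec hψ (show 0 < 2 / (3 * t) by positivity)
  set s := posInv ψ (2 / (3 * t))
  obtain ⟨q, p₁, p₂, g0, g1, g2, g3⟩ := exists_simultaneous_of_uniform (Θ 0 0) (Θ 0 1)
    (fun _ => hψ.pos) (fun c hc => (hψ_dec.exists_forall_ge_le hψ hc).imp fun _ h => h.2)
    hf_dec hT₀ h1 h3 (by linarith [hS s h2])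
  have e : 2 * (s * ψ s) = 4 / (3 * t) * s := by rw [hs]; ring
  have e' : 2 / (3 * ψ s) = t := by rw [hs]; field_simp
  rw [e] at g2 g3
  rw [e'] at g1
  exact ⟨q, p₁, p₂, g0, g1, g2, g3⟩

theorem uniformlyApproximable_of_transpose_of_monotoneOn {Θ : Matrix (Fin 1) (Fin 2) ℝ}
    {ψ : ℝ → ℝ} (hψ : PosInvertible ψ) (hψ_dec : AntitoneOn ψ (Ioi 0))
    (hf : PosInvertible (fun t => t * ψ t)) (hf_inc : MonotoneOn (fun t => t * ψ t) (Ioi 0))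
    (h : UniformlyApproximable Θᵀ ψ) :
    UniformlyApproximable Θ (fun t => 2 / (3 * posInv (fun s => s * ψ s) (t / 2))) := by
  rw [uniformlyApproximable_row_iff]
  rw [uniformlyApproximable_column_iff] at h
  -- If some `q` annihilates both errors, then `(q, 0)` is an exact zero of the linear form modulo 1
  -- and serves every large `t`.
  by_cases hirr : ∀ q p₁ p₂ : ℤ, q ≠ 0 → 0 < max |Θ 0 0 * q - p₁| |Θ 0 1 * q - p₂|
  · obtain ⟨T₀, hT₀⟩ := eventually_atTop.1 h
    obtain ⟨q, p₁, p₂, hq, -, hmin⟩ :=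
      exists_simultaneous_min (Θ 0 0) (Θ 0 1) (le_max_right T₀ 1)
    have hA := hirr q p₁ p₂ hq
    -- Halving the least error up to the threshold gives the strict inequality that excludes small
    -- denominators.
    obtain ⟨S, -, hS⟩ := hψ_dec.exists_forall_ge_le hψ (half_pos hA)
    filter_upwards [eventually_gt_atTop 0, hf_inc.eventually_le_posInv hf (max T₀ 1),
      hf_inc.eventually_le_posInv hf S] with t ht h1 h2
    obtain ⟨-, hs, -⟩ := posInv_spec hf (show 0 < t / 2 by positivity)
    set s := posInv (fun s => s * ψ s) (t / 2)
    have key := exists_linear_form_of_uniform (Θ 0 0) (Θ 0 1) (fun _ => hψ.pos) hf_inc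
      (fun t ht => hT₀ t ((le_max_left T₀ 1).trans ht)) hirr (le_max_right T₀ 1) h1
      (fun q' p₁' p₂' h0 h3 => by linarith [hmin q' p₁' p₂' h0 h3, hS s h2])
    have hs' : s * ψ s = t / 2 := hs
    rwa [hs', mul_div_cancel₀ _ (two_ne_zero' ℝ)] at key
  · obtain ⟨q, p₁, p₂, hq, hle⟩ : ∃ q p₁ p₂ : ℤ, q ≠ 0 ∧
        max |Θ 0 0 * q - p₁| |Θ 0 1 * q - p₂| ≤ 0 := by
      by_contra hc
      exact hirr fun q p₁ p₂ hq => lt_of_not_ge fun hle => hc ⟨q, p₁, p₂, hq, hle⟩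
    have h0 : Θ 0 0 * q - p₁ = 0 :=
      abs_nonpos_iff.1 ((le_max_left _ _).trans hle)
    filter_upwards [eventually_gt_atTop 0, eventually_ge_atTop |(q : ℝ)|] with t ht hqt
    obtain ⟨hs, -, -⟩ := posInv_spec hf (show 0 < t / 2 by positivity)
    refine ⟨q, 0, p₁, Or.inl hq, hqt, by simpa using ht.le, ?_⟩
    have hz : Θ 0 0 * (q : ℝ) + Θ 0 1 * ((0 : ℤ) : ℝ) - p₁ = 0 := by
      rw [Int.cast_zero]
      linarith
    calc _ = (0 : ℝ) := by rw [hz, abs_zero]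
      _ ≤ _ := by positivity

theorem theorem9 (Θ : Matrix (Fin 1) (Fin 2) ℝ) (ψ : ℝ → ℝ)
    (hψ : PosInvertible ψ) (hψ_dec : AntitoneOn ψ (Ioi 0))
    (hf : PosInvertible (fun t => t * ψ t)) :
    (AntitoneOn (fun t => t * ψ t) (Ioi 0) →
      (UniformlyApproximable Θ ψ →
        UniformlyApproximable Θᵀ (fun t => 4 / (3 * t) * posInv ψ (2 / (3 * t)))) ∧
      (∀ ε δ t : ℝ, 0 < ε → 0 < δ → 0 < t →
        4 / (3 * t) * posInv ψ (2 / (3 * t)) < 12 * (1 + ε + δ) / t * posInv ψ (1 / t))) ∧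
    (MonotoneOn (fun t => t * ψ t) (Ioi 0) →
      (UniformlyApproximable Θᵀ ψ →
        UniformlyApproximable Θ (fun t => 2 / (3 * posInv (fun s => s * ψ s) (t / 2)))) ∧
      (∀ ε δ t : ℝ, 0 < ε → 0 < δ → 0 < t →
        2 / (3 * posInv (fun s => s * ψ s) (t / 2))
          < 4 * (1 + ε + δ) / posInv (fun s => s * ψ s) (t / 2))) := by
  refine ⟨fun hf_dec => ⟨uniformlyApproximable_transpose_of_antitoneOn hψ hψ_dec hf hf_dec,
    fun ε δ t hε hδ ht => ?_⟩, fun hf_inc =>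
    ⟨uniformlyApproximable_of_transpose_of_monotoneOn hψ hψ_dec hf hf_inc,
    fun ε δ t hε hδ ht => ?_⟩⟩
  · obtain ⟨hu, hψu, -⟩ := posInv_spec hψ (show 0 < 2 / (3 * t) by positivity)
    obtain ⟨hv, hψv, -⟩ := posInv_spec hψ (show 0 < 1 / t by positivity)
    set u := posInv ψ (2 / (3 * t))
    set v := posInv ψ (1 / t)
    have hvu : v ≤ u := by
      by_contra! hlt
      have h1 := hψ_dec hu hv hlt.le
      rw [hψu, hψv, div_le_div_iff₀ ht (by positivity)] at h1
      linarith
    have h2 : u * ψ u ≤ v * ψ v := hf_dec hv hu hvu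
    rw [hψu, hψv] at h2
    -- Since `t * ψ t` decreases, changing the argument from `2/(3t)` to `1/t` costs at most a
    -- factor 3/2, far below the available 9.
    have h3 : 4 / (3 * t) * u ≤ 2 / t * v := by
      calc 4 / (3 * t) * u = 2 * (u * (2 / (3 * t))) := by ring
        _ ≤ 2 * (v * (1 / t)) := by linarith
        _ = 2 / t * v := by ring
    refine h3.trans_lt ?_
    gcongr
    linarith
  · obtain ⟨hs, -, -⟩ := posInv_spec hf (show 0 < t / 2 by positivity)
    rw [div_lt_div_iff₀ (by positivity) hs]
    nlinarith [mul_pos hε hs, mul_pos hδ hs]
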